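/- Entropies are in bits, with the convention $0\log_2 0=0$: for a random variable $Y$ with finitely many values, $H(Y)=-\sum_y \mathbb P(Y=y)\log_2\mathbb P(Y=y)$, and for $0\le p\le 1$, $h(p)=-p\log_2 p-(1-p)\log_2(1-p)$. For $m\ge 0$ let $B_m\sim\operatorname{Bin}(m,1/2)$. **Theorem.** Let $n\ge 1$ and put $$w_0=\frac{1}{1+2^{-H(B_n)+H(B_{n-1})}} .$$ Let $X_1,\dots,X_n$ be independent random variables taking values in $\{0,1,2\}$, and let $S_n=X_1+\cdots+X_n$. Then $$H(S_n)\le w_0H(B_n)+(1-w_0)H(B_{n-1})+h(w_0).$$ The bound is attained: equality holds whenever $X_1,\dots,X_n$ are independent, $X_1,\dots,X_{n-1}$ are uniform on $\{0,2\}$, and $$\mathbb P(X_n=0)=\mathbb P(X_n=2)=\frac{w_0}{2},\qquad \mathbb P(X_n=1)=1-w_0 ,$$ and such random variables exist. -/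

import Mathlib

open MeasureTheory ProbabilityTheory

/-- Shannon entropy, in bits, of a probability law on `ℕ`:
`-∑ₖ μ{k} log₂ μ{k}`, with the convention `0 log₂ 0 = 0` (a finite sum when `μ` is
concentrated on finitely many integers). -/
noncomputable def shannonEntropy (μ : Measure ℕ) : ℝ :=
  -∑' k : ℕ, μ.real {k} * Real.logb 2 (μ.real {k})

/-- Binary entropy function in bits. -/
noncomputable def binaryEntropy (p : ℝ) : ℝ :=
  -p * Real.logb 2 p - (1 - p) * Real.logb 2 (1 - p)

/-- The parameter `1/2` as a point of the unit interval. -/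
noncomputable def oneHalf : unitInterval := ⟨1 / 2, by norm_num, by norm_num⟩

/-- `H(B_m)`, the entropy of the symmetric binomial law `Bin(m, 1/2)`. -/
noncomputable def binomialEntropy (m : ℕ) : ℝ :=
  shannonEntropy (binomial m oneHalf)

/-- `w₀ = 1 / (1 + 2 ^ (-H(B_n) + H(B_{n-1})))`, meaningful for `n ≥ 1`. -/
noncomputable def optimalWeight (n : ℕ) : ℝ :=
  1 / (1 + (2 : ℝ) ^ (-binomialEntropy n + binomialEntropy (n - 1)))

/-- `w₀ H(B_n) + (1 - w₀) H(B_{n-1}) + h(w₀)`, meaningful for `n ≥ 1`. -/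
noncomputable def maximalEntropy (n : ℕ) : ℝ :=
  optimalWeight n * binomialEntropy n + (1 - optimalWeight n) * binomialEntropy (n - 1)
    + binaryEntropy (optimalWeight n)

/-- All variables but the last one are uniform on `{0, 2}`, and the last one has masses
`w₀/2`, `1 - w₀`, `w₀/2` at `0`, `1`, `2`. (These are laws with total mass one, so no mass
is left for other values.) -/
def HasExtremalLaws {Ω : Type*} [MeasurableSpace Ω] (P : Measure Ω) {n : ℕ}
    (X : Fin n → Ω → ℕ) : Prop :=
  ∀ i : Fin n,
    ((i : ℕ) + 1 < n → P.real {ω | X i ω = 0} = 1 / 2 ∧ P.real {ω | X i ω = 2} = 1 / 2) ∧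
    ((i : ℕ) + 1 = n →
      P.real {ω | X i ω = 0} = optimalWeight n / 2 ∧
      P.real {ω | X i ω = 2} = optimalWeight n / 2 ∧
      P.real {ω | X i ω = 1} = 1 - optimalWeight n)

/-! The generating function of `S_n` is a product of quadratics `a + b x + c x²` with nonnegative
coefficients. Each is nonzero for `Re x > 0` and satisfies `|p(-x)| ≤ |p(x)|` there; keeping track
of when equality occurs, the product inherits this (`DominatesReflection`). Write it as `E(x²) + x
O(x²)`. By Hermite–Biehler, `E` and `O`, where nonzero, have only real nonpositive roots, so each is
a constant times a product of factors `(1 - p) + p x`. Thus, given its parity, `⌊S_n / 2⌋` is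
distributed as a sum of `n` (even) or `n - 1` (odd) independent Bernoulli variables.

Such sums have entropy at most that of the symmetric binomial law (`natEntropy_bernoulliPoly_le`).
Gibbs' inequality bounds the entropy by the cross entropy with the binomial law of the same mean, `n
h(p) - E log (n choose K)`. Since `log (n choose k)` is concave in `k`, Hoeffding's inequality
allows `K` to be replaced by the binomial variable, and the entropy of `Bin(n, p)` is symmetric and
concave in `p`, hence largest at `1/2`.

The entropy of `S_n` is therefore at most that of a mixture of disjoint laws with entropies `H(B_n)`
and `H(B_{n-1})`, and `w₀` is the best weight. For the extremal laws both parity classes are exactly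
binomial, so equality holds. -/

section EntropyOfSums

open Polynomial

/-! ### Domination of the reflection on the right half plane -/

/-- A real polynomial which does not vanish on the open right half plane and either is even, or
is odd, or is larger in absolute value at `x` than at `-x` throughout that half plane. -/
def DominatesReflection (p : ℝ[X]) : Prop :=
  (∀ x : ℂ, 0 < x.re → aeval x p ≠ 0) ∧
  ((∀ x : ℂ, 0 < x.re → ‖aeval (-x) p‖ < ‖aeval x p‖) ∨
    (∀ x : ℂ, aeval (-x) p = aeval x p) ∨ (∀ x : ℂ, aeval (-x) p = -aeval x p))

namespace DominatesReflection

lemma norm_le {p : ℝ[X]} (hp : DominatesReflection p) {x : ℂ} (hx : 0 < x.re) :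
    ‖aeval (-x) p‖ ≤ ‖aeval x p‖ := by
  rcases hp.2 with h | h | h
  · exact (h x hx).le
  · rw [h]
  · rw [h, norm_neg]

/-- One strict factor makes the product strict, because the other factor does not vanish and
satisfies the weak inequality; otherwise parities multiply. -/
lemma mul {p q : ℝ[X]} (hp : DominatesReflection p) (hq : DominatesReflection q) :
    DominatesReflection (p * q) := by
  refine ⟨fun x hx => by simpa using ⟨hp.1 x hx, hq.1 x hx⟩, ?_⟩
  have key : ((∀ x : ℂ, 0 < x.re → ‖aeval (-x) p‖ < ‖aeval x p‖) ∨
      (∀ x : ℂ, 0 < x.re → ‖aeval (-x) q‖ < ‖aeval x q‖)) →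
      ∀ x : ℂ, 0 < x.re → ‖aeval (-x) (p * q)‖ < ‖aeval x (p * q)‖ := by
    intro h x hx
    rw [map_mul, map_mul, norm_mul, norm_mul]
    rcases h with h | h
    · exact mul_lt_mul_of_lt_of_le_of_nonneg_of_pos (h x hx) (hq.norm_le hx) (norm_nonneg _)
        (norm_pos_iff.2 (hq.1 x hx))
    · exact mul_lt_mul' (hp.norm_le hx) (h x hx) (norm_nonneg _) (norm_pos_iff.2 (hp.1 x hx))
  rcases hp.2 with h | h | h
  · exact .inl (key (.inl h))
  all_goals rcases hq.2 with h' | h' | h'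
  all_goals first
    | exact .inl (key (.inr h'))
    | (refine .inr (.inl fun x => ?_); simp [h, h']; done)
    | (refine .inr (.inr fun x => ?_); simp [h, h'])

lemma prod {ι : Type*} (s : Finset ι) (f : ι → ℝ[X]) (h : ∀ i ∈ s, DominatesReflection (f i)) :
    DominatesReflection (∏ i ∈ s, f i) := by
  refine Finset.prod_induction f DominatesReflection (fun _ _ => mul) ⟨?_, ?_⟩ h
  · simp
  · exact .inr (.inl fun x => by simp)

/-- The identity `|p(x)|² - |p(-x)|² = 4 b Re x (a + c |x|²)` gives strictness unless `b = 0` (even)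
or `a = c = 0` (odd). -/
lemma quadratic {a b c : ℝ} (ha : 0 ≤ a) (hb : 0 ≤ b) (hc : 0 ≤ c) (habc : 0 < a + b + c) :
    DominatesReflection (C a + C b * X + C c * X ^ 2) := by
  have hev : ∀ x : ℂ, aeval x (C a + C b * X + C c * X ^ 2 : ℝ[X]) =
      (a : ℂ) + b * x + c * x ^ 2 := fun x => by simp
  rcases hb.eq_or_lt with hb0 | hb0
  · subst hb0
    refine ⟨fun x hx h0 => ?_, .inr (.inl fun x => by rw [hev, hev]; simp)⟩
    rw [hev] at h0
    have hre := congrArg Complex.re h0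
    have him := congrArg Complex.im h0
    simp [pow_two] at hre him
    have hx0 := hx.ne'
    rcases hc.eq_or_lt with hc0 | hc0
    · subst hc0; simp at hre; linarith
    · have : x.im = 0 := by
        rcases him with h | h
        · exact absurd h hc0.ne'
        · have : x.re * x.im = 0 := by linarith
          exact (mul_eq_zero.1 this).resolve_left hx0
      rw [this] at hre
      nlinarith [mul_pos hc0 (mul_pos hx hx)]
  rcases (add_nonneg ha hc).eq_or_lt with hac | hac
  · obtain rfl : a = 0 := by linarith
    obtain rfl : c = 0 := by linarith
    refine ⟨fun x hx h0 => ?_, .inr (.inr fun x => by rw [hev, hev]; simp)⟩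
    rw [hev] at h0
    have hre := congrArg Complex.re h0
    simp at hre
    rcases hre with h | h
    · exact hb0.ne' h
    · exact hx.ne' h
  have hlt : ∀ x : ℂ, 0 < x.re → ‖aeval (-x) (C a + C b * X + C c * X ^ 2 : ℝ[X])‖ <
      ‖aeval x (C a + C b * X + C c * X ^ 2 : ℝ[X])‖ := by
    intro x hx
    rw [hev, hev, ← sq_lt_sq₀ (norm_nonneg _) (norm_nonneg _), ← Complex.normSq_eq_norm_sq,
      ← Complex.normSq_eq_norm_sq, Complex.normSq_apply, Complex.normSq_apply]
    simp [pow_two]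
    have : 0 < b * x.re * (a + c * (x.re ^ 2 + x.im ^ 2)) := by
      refine mul_pos (mul_pos hb0 hx) ?_
      rcases ha.eq_or_lt with h | h
      · subst h
        have : 0 < c := by linarith
        positivity
      · positivity
    nlinarith
  refine ⟨fun x hx h0 => ?_, .inl hlt⟩
  have := hlt x hx
  rw [h0, norm_zero] at this
  exact absurd this (norm_nonneg _).not_gt

end DominatesReflection

/-! ### Even and odd parts, Hermite–Biehler -/

namespace Polynomial

lemma expand_contract_two_add (p : ℝ[X]) :
    expand ℝ 2 (contract 2 p) + X * expand ℝ 2 (contract 2 p.divX) = p := by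
  ext k
  rcases Nat.even_or_odd' k with ⟨j, rfl | rfl⟩
  · have : (X * expand ℝ 2 (contract 2 p.divX)).coeff (2 * j) = 0 := by
      rcases j with _ | j
      · simp
      · rw [show 2 * (j + 1) = 2 * j + 1 + 1 by ring, coeff_X_mul, coeff_expand two_pos,
          if_neg (by omega)]
    rw [coeff_add, this, coeff_expand_mul' two_pos, coeff_contract two_ne_zero, add_zero, mul_comm]
  · rw [coeff_add, coeff_X_mul, coeff_expand two_pos, if_neg (by omega), zero_add,
      coeff_expand_mul' two_pos, coeff_contract two_ne_zero, coeff_divX, mul_comm]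

lemma aeval_eq_even_add_odd (p : ℝ[X]) (x : ℂ) :
    aeval x p = aeval (x ^ 2) (contract 2 p) + x * aeval (x ^ 2) (contract 2 p.divX) := by
  conv_lhs => rw [← expand_contract_two_add p]
  simp [expand_aeval]

lemma eq_zero_of_aeval_sq {q : ℝ[X]} (h : ∀ x : ℂ, x ≠ 0 → aeval (x ^ 2) q = 0) : q = 0 := by
  refine eq_zero_of_infinite_isRoot q ?_
  refine (Set.Ioi_infinite (0 : ℝ)).mono fun t ht => ?_
  have ht' : (0 : ℝ) < t := ht
  have := h (Real.sqrt t : ℂ) (by simpa using (Real.sqrt_pos.2 ht').ne')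
  rw [← Complex.ofReal_pow, Real.sq_sqrt ht'.le] at this
  have h2 : ((eval t q : ℝ) : ℂ) = 0 := by
    rw [← this]
    exact (aeval_algebraMap_apply_eq_algebraMap_eval (A := ℂ) t q).symm
  simpa using h2

end Polynomial

lemma exists_sq_eq_re_pos {z : ℂ} (hz : ¬ (z.im = 0 ∧ z.re ≤ 0)) :
    ∃ x : ℂ, x ^ 2 = z ∧ 0 < x.re := by
  obtain ⟨y, hy'⟩ := IsAlgClosed.exists_pow_nat_eq z two_pos
  have hy := hy'.symm
  have hre : y.re ≠ 0 := by
    intro h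
    apply hz
    rw [hy, sq]
    simp only [Complex.mul_im, Complex.mul_re, h]
    constructor
    · ring
    · nlinarith [mul_self_nonneg y.im]
  rcases hre.lt_or_gt with h | h
  · exact ⟨-y, by rw [neg_sq, hy], by simpa using h⟩
  · exact ⟨y, hy.symm, h⟩

/-- The Hermite–Biehler theorem: the even and the odd part have only real nonpositive roots. -/
lemma DominatesReflection.roots_even {p : ℝ[X]} (hp : DominatesReflection p)
    (h0 : contract 2 p ≠ 0) {z : ℂ} (hz : aeval z (contract 2 p) = 0) : z.im = 0 ∧ z.re ≤ 0 := by
  by_contra hc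
  obtain ⟨x, rfl, hx⟩ := exists_sq_eq_re_pos hc
  have h1 := aeval_eq_even_add_odd p x
  have h2 := aeval_eq_even_add_odd p (-x)
  rw [neg_sq] at h2
  rw [hz, zero_add] at h1 h2
  -- At a root `x²` of the even part, `p(-x) = -p(x)`. This contradicts strict domination; if `p` is
  -- even it forces `p(x) = 0`; if `p` is odd the even part is zero.
  rcases hp.2 with h | h | h
  · have := h x hx
    rw [h2, h1, neg_mul, norm_neg] at this
    exact lt_irrefl _ this
  · have := h x
    rw [h2, neg_mul, ← h1] at this
    exact hp.1 x hx (neg_eq_self.1 this)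
  · refine h0 (eq_zero_of_aeval_sq fun y _ => ?_)
    have h3 := aeval_eq_even_add_odd p y
    have h4 := aeval_eq_even_add_odd p (-y)
    rw [neg_sq, h y, h3] at h4
    linear_combination -(1/2 : ℂ) * h4

lemma DominatesReflection.roots_odd {p : ℝ[X]} (hp : DominatesReflection p)
    (h0 : contract 2 p.divX ≠ 0) {z : ℂ} (hz : aeval z (contract 2 p.divX) = 0) :
    z.im = 0 ∧ z.re ≤ 0 := by
  by_contra hc
  obtain ⟨x, rfl, hx⟩ := exists_sq_eq_re_pos hc
  have h1 := aeval_eq_even_add_odd p x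
  have h2 := aeval_eq_even_add_odd p (-x)
  rw [neg_sq] at h2
  rw [hz, mul_zero, add_zero] at h1 h2
  rcases hp.2 with h | h | h
  · have := h x hx
    rw [h2, h1] at this
    exact lt_irrefl _ this
  · refine h0 (eq_zero_of_aeval_sq fun y hy => ?_)
    have h3 := aeval_eq_even_add_odd p y
    have h4 := aeval_eq_even_add_odd p (-y)
    rw [neg_sq, h y, h3] at h4
    have : y * aeval (y ^ 2) (contract 2 p.divX) = 0 := by linear_combination (1/2 : ℂ) * h4
    exact (mul_eq_zero.1 this).resolve_left hy
  · have := h x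
    rw [h2, ← h1] at this
    exact hp.1 x hx (self_eq_neg.1 this)

/-! ### Real-rooted polynomials as Bernoulli sums -/

/-- The generating function of a sum of independent Bernoulli variables with the parameters
in `s`. -/
noncomputable def bernoulliPoly (s : Multiset ℝ) : ℝ[X] :=
  (s.map fun p => C (1 - p) + C p * X).prod

/-- A root `-r` with `r ≥ 0` gives `x + r = (1 + r) ((1 - p) + p x)` with `p = 1 / (1 + r)`.
Parameters `0` contribute the factor `1` and pad the multiset to size `n`. -/
lemma exists_bernoulliPoly (n : ℕ) (q : ℝ[X]) (hn : q.natDegree ≤ n)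
    (hq : ∀ z : ℂ, aeval z q = 0 → z.im = 0 ∧ z.re ≤ 0) :
    ∃ s : Multiset ℝ, s.card = n ∧ (∀ p ∈ s, 0 ≤ p ∧ p ≤ 1) ∧
      q = C (q.eval 1) * bernoulliPoly s := by
  induction n generalizing q with
  | zero =>
    refine ⟨0, rfl, by simp, ?_⟩
    rw [eq_C_of_natDegree_le_zero hn]
    simp [bernoulliPoly]
  | succ n ih =>
    by_cases hd : q.natDegree = 0
    · refine ⟨Multiset.replicate (n + 1) 0, by simp, ?_, ?_⟩
      · intro p hp
        rw [Multiset.eq_of_mem_replicate hp]; simp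
      · rw [eq_C_of_natDegree_eq_zero hd]
        simp [bernoulliPoly]
    obtain ⟨z, hz⟩ := IsAlgClosed.exists_aeval_eq_zero ℂ q
      fun h => hd (natDegree_eq_of_degree_eq_some h)
    obtain ⟨him, hre⟩ := hq z hz
    obtain ⟨r, rfl⟩ : ∃ r : ℝ, z = ((-r : ℝ) : ℂ) :=
      ⟨-z.re, Complex.ext (by simp) (by simp [him])⟩
    have hr : 0 ≤ r := by simpa using hre
    have hroot : q.IsRoot (-r) := by
      have h2 : ((eval (-r) q : ℝ) : ℂ) = 0 := by
        rw [← hz]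
        exact (aeval_algebraMap_apply_eq_algebraMap_eval (A := ℂ) (-r) q).symm
      simpa using h2
    obtain ⟨q', hq'⟩ := dvd_iff_isRoot.2 hroot
    have hq0 : q' ≠ 0 := by
      rintro rfl
      rw [hq'] at hd; simp at hd
    have hdeg : q'.natDegree ≤ n := by
      rw [hq', natDegree_mul (X_sub_C_ne_zero _) hq0, natDegree_X_sub_C] at hn
      omega
    obtain ⟨s, hs, hs1, hs2⟩ := ih q' hdeg fun z hz => hq z (by rw [hq', map_mul, hz, mul_zero])
    have h1r : (1 + r) ≠ 0 := by positivity
    refine ⟨(1 / (1 + r)) ::ₘ s, by simp [hs], ?_, ?_⟩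
    · intro p hp
      rcases Multiset.mem_cons.1 hp with rfl | hp
      · exact ⟨by positivity, by rw [div_le_one (by positivity)]; linarith⟩
      · exact hs1 p hp
    · have hfac : (X - C (-r) : ℝ[X]) =
          C (1 + r) * (C (1 - 1 / (1 + r)) + C (1 / (1 + r)) * X) := by
        rw [mul_add, ← mul_assoc, ← C_mul, ← C_mul, mul_one_div_cancel h1r,
          show (1 + r) * (1 - 1 / (1 + r)) = r by field_simp; ring]
        simp; ring
      have hcons : bernoulliPoly ((1 / (1 + r)) ::ₘ s) =
          (C (1 - 1 / (1 + r)) + C (1 / (1 + r)) * X) * bernoulliPoly s := by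
        simp [bernoulliPoly]
      have he : q.eval 1 = (1 + r) * q'.eval 1 := by rw [hq']; simp
      rw [hcons, he, C_mul]
      calc q = (X - C (-r)) * q' := hq'
        _ = _ := by rw [hfac]; conv_lhs => rw [hs2]
                    ring

/-! ### Expectations under Bernoulli sums and Hoeffding's inequality -/

namespace Polynomial

/-- The linear functional `∑ cₖ xᵏ ↦ ∑ cₖ aₖ`. -/
noncomputable def pairing (a : ℕ → ℝ) : ℝ[X] →ₗ[ℝ] ℝ :=
  lsum fun k => a k • LinearMap.id

lemma pairing_apply (a : ℕ → ℝ) (q : ℝ[X]) {N : ℕ} (hN : q.natDegree < N) :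
    pairing a q = ∑ k ∈ Finset.range N, q.coeff k * a k := by
  rw [pairing, lsum_apply, sum_over_range' _ (by simp) N hN]
  simp [mul_comm]

lemma pairing_one (q : ℝ[X]) : pairing (fun _ => 1) q = q.eval 1 := by
  rw [pairing_apply _ _ (Nat.lt_succ_self _), eval_eq_sum_range]
  simp

lemma pairing_X_mul (a : ℕ → ℝ) (q : ℝ[X]) :
    pairing a (X * q) = pairing (fun k => a (k + 1)) q := by
  rw [pairing_apply a (X * q) (N := q.natDegree + 1 + 1),
    pairing_apply _ q (N := q.natDegree + 1) (by omega), Finset.sum_range_succ']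
  · simp
  · have := natDegree_mul_le (p := (X : ℝ[X])) (q := q)
    rw [natDegree_X] at this
    omega

/-- Conditioning on one Bernoulli summand; this recursion drives the inductions on the parameters.
-/
lemma pairing_bernoulli_mul (a : ℕ → ℝ) (p : ℝ) (q : ℝ[X]) :
    pairing a ((C (1 - p) + C p * X) * q) =
      (1 - p) * pairing a q + p * pairing (fun k => a (k + 1)) q := by
  rw [add_mul, mul_assoc, map_add, ← smul_eq_C_mul, ← smul_eq_C_mul, map_smul, map_smul,
    pairing_X_mul, smul_eq_mul, smul_eq_mul]

lemma pairing_add (a b : ℕ → ℝ) (q : ℝ[X]) :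
    pairing (fun k => a k + b k) q = pairing a q + pairing b q := by
  simp only [pairing_apply _ q (Nat.lt_succ_self _), mul_add, Finset.sum_add_distrib]

lemma pairing_sub (a b : ℕ → ℝ) (q : ℝ[X]) :
    pairing (fun k => a k - b k) q = pairing a q - pairing b q := by
  simp only [pairing_apply _ q (Nat.lt_succ_self _), mul_sub, Finset.sum_sub_distrib]

lemma pairing_const_mul (c : ℝ) (a : ℕ → ℝ) (q : ℝ[X]) :
    pairing (fun k => c * a k) q = c * pairing a q := by
  simp only [pairing_apply _ q (Nat.lt_succ_self _), Finset.mul_sum]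
  exact Finset.sum_congr rfl fun _ _ => by ring

lemma pairing_mono {a b : ℕ → ℝ} {q : ℝ[X]} (hq : ∀ k, 0 ≤ q.coeff k) {n : ℕ}
    (hn : q.natDegree ≤ n) (h : ∀ k ≤ n, a k ≤ b k) : pairing a q ≤ pairing b q := by
  rw [pairing_apply _ q (Nat.lt_succ_of_le hn), pairing_apply _ q (Nat.lt_succ_of_le hn)]
  exact Finset.sum_le_sum fun k hk =>
    mul_le_mul_of_nonneg_left (h k (Nat.lt_succ_iff.1 (Finset.mem_range.1 hk))) (hq k)

end Polynomial

lemma bernoulliPoly_cons (p : ℝ) (s : Multiset ℝ) :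
    bernoulliPoly (p ::ₘ s) = (C (1 - p) + C p * X) * bernoulliPoly s := by
  simp [bernoulliPoly]

lemma natDegree_bernoulliPoly_le (s : Multiset ℝ) : (bernoulliPoly s).natDegree ≤ s.card := by
  induction s using Multiset.induction_on with
  | empty => simp [bernoulliPoly]
  | cons p s ih =>
    have hlin : (C (1 - p) + C p * X).natDegree ≤ 1 := by
      rw [add_comm]
      exact natDegree_linear_le
    have hmul := natDegree_mul_le (p := C (1 - p) + C p * X) (q := bernoulliPoly s)
    rw [bernoulliPoly_cons, Multiset.card_cons]
    omega

lemma bernoulliPoly_coeff_nonneg {s : Multiset ℝ} (hs : ∀ p ∈ s, 0 ≤ p ∧ p ≤ 1) (k : ℕ) :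
    0 ≤ (bernoulliPoly s).coeff k := by
  induction s using Multiset.induction_on generalizing k with
  | empty => simp only [bernoulliPoly, Multiset.map_zero, Multiset.prod_zero, coeff_one]; positivity
  | cons p s ih =>
    have ih := ih fun q hq => hs q (Multiset.mem_cons_of_mem hq)
    have hp := hs p (Multiset.mem_cons_self p s)
    rw [bernoulliPoly_cons, add_mul, mul_assoc, coeff_add, coeff_C_mul, coeff_C_mul]
    refine add_nonneg (mul_nonneg (by linarith) (ih k)) (mul_nonneg hp.1 ?_)
    cases k with
    | zero => simp
    | succ k => rw [coeff_X_mul]; exact ih k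

lemma bernoulliPoly_eval_one (s : Multiset ℝ) : (bernoulliPoly s).eval 1 = 1 := by
  induction s using Multiset.induction_on with
  | empty => simp [bernoulliPoly]
  | cons p s ih => rw [bernoulliPoly_cons]; simp [ih]

lemma pairing_id_bernoulliPoly (s : Multiset ℝ) :
    pairing (fun k => (k : ℝ)) (bernoulliPoly s) = s.sum := by
  induction s using Multiset.induction_on with
  | empty =>
    rw [pairing_apply _ _ (N := 1) (by simp [bernoulliPoly])]
    simp
  | cons p s ih =>
    rw [bernoulliPoly_cons, pairing_bernoulli_mul]
    simp only [Nat.cast_add, Nat.cast_one]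
    rw [pairing_add, pairing_one, bernoulliPoly_eval_one, ih, Multiset.sum_cons]
    ring

lemma coeff_bernoulliPoly_replicate (n : ℕ) (p : ℝ) (k : ℕ) :
    (bernoulliPoly (Multiset.replicate n p)).coeff k = n.choose k * p ^ k * (1 - p) ^ (n - k) := by
  have : bernoulliPoly (Multiset.replicate n p) = ((X + C (1 - p)) ^ n).comp (C p * X) := by
    simp [bernoulliPoly, add_comm]
  rw [this, comp_C_mul_X_coeff, coeff_X_add_C_pow]
  ring

/-- Replacing a pair of parameters `i ≤ p ≤ j` by `p` and `i + j - p` makes the expectation of a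
concave sequence smaller. -/
lemma pairing_bernoulliPoly_contract {a : ℕ → ℝ} {n : ℕ}
    (ha : ∀ k, k + 2 ≤ n → a k + a (k + 2) ≤ 2 * a (k + 1)) {i j p : ℝ} (hi : i ≤ p) (hj : p ≤ j)
    {u : Multiset ℝ} (hu : ∀ p ∈ u, 0 ≤ p ∧ p ≤ 1) (hn : u.card + 2 ≤ n) :
    pairing a (bernoulliPoly (p ::ₘ (i + j - p) ::ₘ u)) ≤
      pairing a (bernoulliPoly (i ::ₘ j ::ₘ u)) := by
  simp only [bernoulliPoly_cons, pairing_bernoulli_mul]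
  have h : pairing (fun k => a k + a (k + 2)) (bernoulliPoly u) ≤
      pairing (fun k => 2 * a (k + 1)) (bernoulliPoly u) :=
    pairing_mono (bernoulliPoly_coeff_nonneg hu) (natDegree_bernoulliPoly_le u)
      fun k hk => ha k (by omega)
  rw [pairing_add, pairing_const_mul] at h
  simp only [add_assoc, one_add_one_eq_two]
  -- The sum of the two parameters is unchanged and their product grows by `(p - i) (j - p)`, which
  -- multiplies the expected second difference of `a`.
  nlinarith [mul_nonneg (sub_nonneg.2 hi) (sub_nonneg.2 hj)]

/-- Hoeffding's inequality: among the sums of independent Bernoulli variables with a given mean,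
the binomial one minimizes the expectation of concave functions. -/
lemma pairing_replicate_le {a : ℕ → ℝ} {n : ℕ}
    (ha : ∀ k, k + 2 ≤ n → a k + a (k + 2) ≤ 2 * a (k + 1)) {p : ℝ} (hp : 0 ≤ p ∧ p ≤ 1)
    (c : ℕ) (t : Multiset ℝ) (m : ℕ) (hc : t.card = c) (ht : ∀ q ∈ t, 0 ≤ q ∧ q ≤ 1)
    (hsum : t.sum = c * p) (hn : m + c ≤ n) :
    pairing a (bernoulliPoly (Multiset.replicate (m + c) p)) ≤
      pairing a (bernoulliPoly (Multiset.replicate m p + t)) := by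
  -- `m` parameters already equal `p`, and the `c` others have mean `p`. Some `i ≤ p ≤ j` occur
  -- among these; contracting that pair creates another copy of `p` and preserves the sum.
  induction c generalizing t m with
  | zero =>
    obtain rfl := Multiset.card_eq_zero.1 hc
    simp
  | succ c ih =>
    have hi : ∃ i ∈ t, i ≤ p := by
      by_contra! h
      have := Multiset.card_nsmul_le_sum (s := t) (a := p) fun x hx => (h x hx).le
      obtain ⟨x, hx⟩ := Multiset.card_pos_iff_exists_mem.1 (by omega : 0 < t.card)
      obtain ⟨t', rfl⟩ := Multiset.exists_cons_of_mem hx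
      have h2 := Multiset.card_nsmul_le_sum (s := t') (a := p)
        fun x hx => (h x (Multiset.mem_cons_of_mem hx)).le
      have h3 := h x hx
      simp only [Multiset.card_cons, Multiset.sum_cons, add_left_inj, nsmul_eq_mul] at *
      subst hc
      push_cast at hsum
      linarith
    obtain ⟨i, hit, hip⟩ := hi
    obtain ⟨t, rfl⟩ := Multiset.exists_cons_of_mem hit
    simp only [Multiset.card_cons, Multiset.sum_cons, add_left_inj] at hc hsum
    push_cast at hsum
    rcases Nat.eq_zero_or_pos c with rfl | hcpos
    · obtain rfl := Multiset.card_eq_zero.1 hc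
      have : i = p := by simpa using hsum
      subst this
      rw [Multiset.replicate_add]
      simp
    have hj : ∃ j ∈ t, p ≤ j := by
      by_contra! h
      obtain ⟨x, hx⟩ := Multiset.card_pos_iff_exists_mem.1 (by omega : 0 < t.card)
      obtain ⟨t', rfl⟩ := Multiset.exists_cons_of_mem hx
      have h2 := Multiset.sum_le_card_nsmul t' p
        fun x hx => (h x (Multiset.mem_cons_of_mem hx)).le
      have h3 := h x hx
      simp only [Multiset.card_cons, Multiset.sum_cons, nsmul_eq_mul] at *
      subst hc
      push_cast at hsum
      linarith
    obtain ⟨j, hjt, hpj⟩ := hj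
    obtain ⟨u, rfl⟩ := Multiset.exists_cons_of_mem hjt
    have hu : ∀ q ∈ u, 0 ≤ q ∧ q ≤ 1 := fun q hq =>
      ht q (Multiset.mem_cons_of_mem (Multiset.mem_cons_of_mem hq))
    have hi01 := ht i (Multiset.mem_cons_self _ _)
    have hj01 := ht j (Multiset.mem_cons_of_mem (Multiset.mem_cons_self _ _))
    have step := pairing_bernoulliPoly_contract (u := Multiset.replicate m p + u) ha hip hpj
      (fun q hq => by
        rcases Multiset.mem_add.1 hq with hq | hq
        · rw [Multiset.eq_of_mem_replicate hq]; exact hp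
        · exact hu q hq)
      (by simp only [Multiset.card_cons] at hc; simp; omega)
    have hrec := ih ((i + j - p) ::ₘ u) (m + 1) (by simpa using hc)
      (fun q hq => by
        rcases Multiset.mem_cons.1 hq with rfl | hq
        · exact ⟨by linarith, by linarith⟩
        · exact hu q hq)
      (by simp only [Multiset.sum_cons] at hsum ⊢; linarith) (by omega)
    rw [show m + (c + 1) = m + 1 + c by ring]
    refine hrec.trans (le_trans (le_of_eq ?_) (step.trans (le_of_eq ?_)))
    · congr 2
      rw [Multiset.replicate_succ, Multiset.cons_add, Multiset.add_cons]
    · congr 2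
      simp

/-- Each of the `n + 1` equal parameters contributes the same derivative, the effect of switching
one summand from `0` to `1`. -/
lemma hasDerivAt_pairing_replicate (n : ℕ) (a : ℕ → ℝ) (p : ℝ) :
    HasDerivAt (fun p => pairing a (bernoulliPoly (Multiset.replicate (n + 1) p)))
      ((n + 1) * pairing (fun k => a (k + 1) - a k) (bernoulliPoly (Multiset.replicate n p))) p := by
  have hone : HasDerivAt (fun p : ℝ => 1 - p) (-1) p := by
    simpa using (hasDerivAt_id p).const_sub 1
  induction n generalizing a with
  | zero =>
    have : ∀ (b : ℕ → ℝ) (q : ℝ), pairing b (bernoulliPoly (Multiset.replicate 0 q)) = b 0 := by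
      intro b q
      rw [pairing_apply _ _ (N := 1) (by simp [bernoulliPoly])]
      simp [bernoulliPoly]
    simp only [Multiset.replicate_succ, bernoulliPoly_cons, pairing_bernoulli_mul, this]
    refine ((hone.mul_const (a 0)).add ((hasDerivAt_id p).mul_const (a 1))).congr_deriv ?_
    simp; ring
  | succ n ih =>
    have hfun : (fun p => pairing a (bernoulliPoly (Multiset.replicate (n + 1 + 1) p))) = fun p =>
        (1 - p) * pairing a (bernoulliPoly (Multiset.replicate (n + 1) p)) +
        p * pairing (fun k => a (k + 1)) (bernoulliPoly (Multiset.replicate (n + 1) p)) := by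
      funext p
      rw [Multiset.replicate_succ, bernoulliPoly_cons, pairing_bernoulli_mul]
    rw [hfun]
    refine ((hone.mul (ih a)).add ((hasDerivAt_id p).mul (ih fun k => a (k + 1)))).congr_deriv ?_
    have hrec := pairing_bernoulli_mul (fun k => a (k + 1) - a k) p
      (bernoulliPoly (Multiset.replicate n p))
    rw [← bernoulliPoly_cons, ← Multiset.replicate_succ] at hrec
    have hsub := pairing_sub (fun k => a (k + 1)) a (bernoulliPoly (Multiset.replicate (n + 1) p))
    simp only [id]
    push_cast
    linear_combination -hsub - (n + 1) * hrec

/-! ### Entropy and cross entropy in nats -/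

/-- The entropy, in nats, of the coefficient sequence of a polynomial. -/
noncomputable def natEntropy (q : ℝ[X]) : ℝ := q.sum fun _ c => Real.negMulLog c

lemma natEntropy_eq_sum (q : ℝ[X]) {N : ℕ} (hN : q.natDegree < N) :
    natEntropy q = ∑ k ∈ Finset.range N, Real.negMulLog (q.coeff k) :=
  sum_over_range' _ (by simp) N hN

/-- Pointwise Gibbs inequality, from `log t ≤ t - 1` at `t = b / x`. The correction `b - x` cancels
on summing over two laws of equal mass. -/
lemma negMulLog_le_neg_mul_log_add {x b : ℝ} (hx : 0 ≤ x) (hb : 0 < b) :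
    Real.negMulLog x ≤ -(x * Real.log b) + (b - x) := by
  rcases hx.eq_or_lt with rfl | hx
  · simpa using hb.le
  have h := Real.log_le_sub_one_of_pos (div_pos hb hx)
  rw [Real.log_div hb.ne' hx.ne'] at h
  have h2 := mul_le_mul_of_nonneg_left h hx.le
  rw [mul_sub, mul_sub, mul_div_cancel₀ _ hx.ne'] at h2
  rw [Real.negMulLog]
  linarith

/-- The entropy, in nats, of the binomial law: `n` times the binary entropy minus the mean of
`log (n.choose k)`. -/
noncomputable def binomialNatEntropy (n : ℕ) (p : ℝ) : ℝ :=
  n * Real.binEntropy p -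
    pairing (fun k => Real.log (n.choose k)) (bernoulliPoly (Multiset.replicate n p))

lemma sum_coeff_bernoulliPoly (s : Multiset ℝ) :
    ∑ k ∈ Finset.range (s.card + 1), (bernoulliPoly s).coeff k = 1 := by
  rw [← bernoulliPoly_eval_one s, ← pairing_one,
    pairing_apply _ _ (Nat.lt_succ_of_le (natDegree_bernoulliPoly_le s))]
  simp

/-- The cross entropy of a Bernoulli sum and the binomial law with the same mean. -/
lemma sum_coeff_mul_log_binomial {n : ℕ} {s : Multiset ℝ} (hs : s.card = n) {p : ℝ} (hp : 0 < p)
    (hp1 : p < 1) (hsum : s.sum = n * p) :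
    ∑ k ∈ Finset.range (n + 1), -((bernoulliPoly s).coeff k *
        Real.log ((bernoulliPoly (Multiset.replicate n p)).coeff k)) =
      n * Real.binEntropy p - pairing (fun k => Real.log (n.choose k)) (bernoulliPoly s) := by
  have hmean := pairing_id_bernoulliPoly s
  have hd := Nat.lt_succ_of_le (natDegree_bernoulliPoly_le s)
  rw [pairing_apply _ _ hd, hs, hsum] at hmean
  rw [pairing_apply _ _ hd, hs, Real.binEntropy_eq_negMulLog_add_negMulLog_one_sub]
  have hone := sum_coeff_bernoulliPoly s
  rw [hs] at hone
  have : ∀ k ∈ Finset.range (n + 1), -((bernoulliPoly s).coeff k *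
        Real.log ((bernoulliPoly (Multiset.replicate n p)).coeff k)) =
      -Real.log p * ((bernoulliPoly s).coeff k * k) -
        Real.log (1 - p) * (n * (bernoulliPoly s).coeff k - (bernoulliPoly s).coeff k * k) -
        (bernoulliPoly s).coeff k * Real.log (n.choose k) := by
    intro k hk
    have hkn : k ≤ n := Nat.lt_succ_iff.1 (Finset.mem_range.1 hk)
    have h1 : ((n.choose k : ℕ) : ℝ) ≠ 0 := by exact_mod_cast (Nat.choose_pos hkn).ne'
    have h2 : p ^ k ≠ 0 := (pow_pos hp k).ne'
    have h3 : (1 - p) ^ (n - k) ≠ 0 := (pow_pos (sub_pos.2 hp1) _).ne'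
    rw [coeff_bernoulliPoly_replicate, Real.log_mul (mul_ne_zero h1 h2) h3, Real.log_mul h1 h2,
      Real.log_pow, Real.log_pow, Nat.cast_sub hkn]
    ring
  rw [Finset.sum_congr rfl this, Finset.sum_sub_distrib, Finset.sum_sub_distrib, ← Finset.mul_sum,
    ← Finset.mul_sum, Finset.sum_sub_distrib, ← Finset.mul_sum, hmean, hone, Real.negMulLog,
    Real.negMulLog]
  ring

lemma natEntropy_bernoulliPoly_le_crossEntropy {n : ℕ} {s : Multiset ℝ} (hs : s.card = n)
    (hs1 : ∀ q ∈ s, 0 ≤ q ∧ q ≤ 1) {p : ℝ} (hp : 0 < p) (hp1 : p < 1) (hsum : s.sum = n * p) :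
    natEntropy (bernoulliPoly s) ≤
      n * Real.binEntropy p - pairing (fun k => Real.log (n.choose k)) (bernoulliPoly s) := by
  rw [← sum_coeff_mul_log_binomial hs hp hp1 hsum,
    natEntropy_eq_sum _ (Nat.lt_succ_of_le (natDegree_bernoulliPoly_le s)), hs]
  have hone := sum_coeff_bernoulliPoly s
  have hone' := sum_coeff_bernoulliPoly (Multiset.replicate n p)
  rw [hs] at hone
  rw [Multiset.card_replicate] at hone'
  have hle := Finset.sum_le_sum fun k (hk : k ∈ Finset.range (n + 1)) =>
    negMulLog_le_neg_mul_log_add (bernoulliPoly_coeff_nonneg hs1 k)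
      (b := (bernoulliPoly (Multiset.replicate n p)).coeff k) (by
        rw [coeff_bernoulliPoly_replicate]
        have := Nat.choose_pos (Nat.lt_succ_iff.1 (Finset.mem_range.1 hk))
        have := sub_pos.2 hp1
        positivity)
  rw [Finset.sum_add_distrib, Finset.sum_sub_distrib, hone, hone'] at hle
  linarith

lemma natEntropy_replicate {n : ℕ} {p : ℝ} (hp : 0 < p) (hp1 : p < 1) :
    natEntropy (bernoulliPoly (Multiset.replicate n p)) = binomialNatEntropy n p := by
  rw [binomialNatEntropy, ← sum_coeff_mul_log_binomial (Multiset.card_replicate n p) hp hp1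
    (by simp), natEntropy_eq_sum _ (Nat.lt_succ_of_le (natDegree_bernoulliPoly_le _))]
  simp [Real.negMulLog]

/-! ### Concavity of `log (n choose k)` and of the binomial entropy -/

lemma log_choose_succ_sub {n k : ℕ} (hk : k < n) :
    Real.log (n.choose (k + 1)) - Real.log (n.choose k) =
      Real.log ((n : ℝ) - k) - Real.log ((k : ℝ) + 1) := by
  have h := Nat.choose_succ_right_eq n k
  have h1 : ((n.choose k : ℕ) : ℝ) ≠ 0 := by exact_mod_cast (Nat.choose_pos hk.le).ne'
  have h2 : ((n.choose (k + 1) : ℕ) : ℝ) ≠ 0 := by exact_mod_cast (Nat.choose_pos hk).ne'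
  have h3 : (n : ℝ) - k ≠ 0 := sub_ne_zero.2 (by exact_mod_cast hk.ne')
  have h4 : (k : ℝ) + 1 ≠ 0 := by positivity
  have h' : (n.choose (k + 1) : ℝ) * ((k : ℝ) + 1) = n.choose k * ((n : ℝ) - k) := by
    rw [← Nat.cast_sub hk.le]
    exact_mod_cast h
  have := congrArg Real.log h'
  rw [Real.log_mul h2 h4, Real.log_mul h1 h3] at this
  linarith

lemma log_add_one_sub_log_le {x : ℝ} (hx : 0 < x) : Real.log (x + 1) - Real.log x ≤ 1 / x := by
  rw [← Real.log_div (by positivity) hx.ne']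
  refine (Real.log_le_sub_one_of_pos (by positivity)).trans (le_of_eq ?_)
  field_simp
  ring

lemma log_choose_second_difference {m k : ℕ} (hk : k ≤ m) :
    (Real.log ((m + 2).choose (k + 2)) - Real.log ((m + 2).choose (k + 1))) -
        (Real.log ((m + 2).choose (k + 1)) - Real.log ((m + 2).choose k)) =
      -(Real.log ((k : ℝ) + 1 + 1) - Real.log ((k : ℝ) + 1)) -
        (Real.log (((m - k : ℕ) : ℝ) + 1 + 1) - Real.log (((m - k : ℕ) : ℝ) + 1)) := by
  rw [log_choose_succ_sub (by omega : k + 1 < m + 2), log_choose_succ_sub (by omega : k < m + 2),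
    Nat.cast_sub hk]
  push_cast
  rw [show (m : ℝ) + 2 - (k + 1) = m - k + 1 by ring,
    show (m : ℝ) + 2 - k = m - k + 1 + 1 by ring]
  ring

lemma log_choose_concave {n k : ℕ} (hk : k + 2 ≤ n) :
    Real.log (n.choose k) + Real.log (n.choose (k + 2)) ≤ 2 * Real.log (n.choose (k + 1)) := by
  obtain ⟨m, rfl⟩ := Nat.exists_eq_add_of_le' (by omega : 2 ≤ n)
  have h := log_choose_second_difference (by omega : k ≤ m)
  have h1 := Real.log_le_log (by positivity : (0 : ℝ) < (k : ℝ) + 1)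
    (by linarith : (k : ℝ) + 1 ≤ k + 1 + 1)
  have h2 := Real.log_le_log (by positivity : (0 : ℝ) < ((m - k : ℕ) : ℝ) + 1)
    (by linarith : ((m - k : ℕ) : ℝ) + 1 ≤ (m - k : ℕ) + 1 + 1)
  linarith

lemma pairing_replicate_reflect (n : ℕ) (a : ℕ → ℝ) (p : ℝ) :
    pairing a (bernoulliPoly (Multiset.replicate n (1 - p))) =
      pairing (fun k => a (n - k)) (bernoulliPoly (Multiset.replicate n p)) := by
  have hd : ∀ p, (bernoulliPoly (Multiset.replicate n p)).natDegree < n + 1 := fun p =>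
    Nat.lt_succ_of_le (by simpa using natDegree_bernoulliPoly_le (Multiset.replicate n p))
  rw [pairing_apply _ _ (hd _), pairing_apply _ _ (hd _), ← Finset.sum_flip]
  refine Finset.sum_congr rfl fun k hk => ?_
  have hkn : k ≤ n := Nat.lt_succ_iff.1 (Finset.mem_range.1 hk)
  rw [coeff_bernoulliPoly_replicate, coeff_bernoulliPoly_replicate, Nat.choose_symm hkn,
    Nat.sub_sub_self hkn, sub_sub_cancel]
  ring

/-- Termwise, `(m + 1) p P(Bin(m, p) = k) / (k + 1) = P(Bin(m + 1, p) = k + 1)`, so the left side is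
`1 - P(Bin(m + 1, p) = 0)`. -/
lemma mul_pairing_inv_succ_le (m : ℕ) {p : ℝ} (hp1 : p ≤ 1) :
    (m + 1) * p * pairing (fun k => 1 / ((k : ℝ) + 1)) (bernoulliPoly (Multiset.replicate m p))
      ≤ 1 := by
  have hone := sum_coeff_bernoulliPoly (Multiset.replicate (m + 1) p)
  rw [Multiset.card_replicate, Finset.sum_range_succ'] at hone
  rw [pairing_apply _ _ (N := m + 1) (Nat.lt_succ_of_le (by
    simpa using natDegree_bernoulliPoly_le (Multiset.replicate m p))), Finset.mul_sum]
  have h0 : 0 ≤ (bernoulliPoly (Multiset.replicate (m + 1) p)).coeff 0 := by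
    rw [coeff_bernoulliPoly_replicate]
    have := sub_nonneg.2 hp1
    simp only [Nat.choose_zero_right, pow_zero]
    positivity
  have : ∀ k ∈ Finset.range (m + 1),
      (m + 1) * p * ((bernoulliPoly (Multiset.replicate m p)).coeff k * (1 / ((k : ℝ) + 1))) =
      (bernoulliPoly (Multiset.replicate (m + 1) p)).coeff (k + 1) := by
    intro k _
    have h := Nat.add_one_mul_choose_eq m k
    have h' : ((m : ℝ) + 1) * m.choose k = (m + 1).choose (k + 1) * (k + 1) := by exact_mod_cast h
    rw [coeff_bernoulliPoly_replicate, coeff_bernoulliPoly_replicate, Nat.add_sub_add_right,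
      pow_succ]
    have h4 : (k : ℝ) + 1 ≠ 0 := by positivity
    field_simp
    linear_combination p ^ k * (1 - p) ^ (m - k) * p * h'
  rw [Finset.sum_congr rfl this]
  linarith

/-- The second derivative of the entropy of the binomial law in its parameter is not positive. -/
lemma binomial_second_derivative_nonpos (m : ℕ) {p : ℝ} (hp : 0 < p) (hp1 : p < 1) :
    -1 / (p * (1 - p)) ≤ (m + 1) * pairing (fun k =>
      (Real.log ((m + 2).choose (k + 2)) - Real.log ((m + 2).choose (k + 1))) -
        (Real.log ((m + 2).choose (k + 1)) - Real.log ((m + 2).choose k)))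
      (bernoulliPoly (Multiset.replicate m p)) := by
  have hp1' := sub_pos.2 hp1
  have h1 := mul_pairing_inv_succ_le m hp1.le
  have h2 := mul_pairing_inv_succ_le m (p := 1 - p) (by linarith)
  rw [pairing_replicate_reflect] at h2
  -- The second difference is at least `-1/(k+1) - 1/(m-k+1)`. The expectations of these fractions
  -- are at most `1/((m+1)p)` and `1/((m+1)(1-p))`, and `1/p + 1/(1-p) = 1/(p(1-p))`.
  have h3 := pairing_mono (n := m) (q := bernoulliPoly (Multiset.replicate m p))
    (a := fun k => (-1) * (1 / ((k : ℝ) + 1) + 1 / (((m - k : ℕ) : ℝ) + 1)))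
    (b := fun k => (Real.log ((m + 2).choose (k + 2)) - Real.log ((m + 2).choose (k + 1))) -
        (Real.log ((m + 2).choose (k + 1)) - Real.log ((m + 2).choose k)))
    (bernoulliPoly_coeff_nonneg fun q hq => by
      rw [Multiset.eq_of_mem_replicate hq]; exact ⟨hp.le, hp1.le⟩)
    (by simpa using natDegree_bernoulliPoly_le (Multiset.replicate m p))
    (fun k hk => by
      rw [log_choose_second_difference hk]
      have h1 := log_add_one_sub_log_le (x := (k : ℝ) + 1) (by positivity)
      have h2 := log_add_one_sub_log_le (x := ((m - k : ℕ) : ℝ) + 1) (by positivity)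
      linarith)
  rw [pairing_const_mul, pairing_add] at h3
  refine le_trans ?_ (mul_le_mul_of_nonneg_left h3 (by positivity))
  rw [div_le_iff₀ (mul_pos hp hp1')]
  nlinarith [mul_le_mul_of_nonneg_left h1 hp1'.le, mul_le_mul_of_nonneg_left h2 hp.le]

lemma binomialNatEntropy_one_sub (n : ℕ) (p : ℝ) :
    binomialNatEntropy n (1 - p) = binomialNatEntropy n p := by
  rw [binomialNatEntropy, binomialNatEntropy, Real.binEntropy_one_sub, pairing_replicate_reflect]
  have hd : (bernoulliPoly (Multiset.replicate n p)).natDegree < n + 1 :=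
    Nat.lt_succ_of_le (by simpa using natDegree_bernoulliPoly_le (Multiset.replicate n p))
  rw [pairing_apply _ _ hd, pairing_apply _ _ hd]
  congr 1
  refine Finset.sum_congr rfl fun k hk => ?_
  rw [Nat.choose_symm (Nat.lt_succ_iff.1 (Finset.mem_range.1 hk))]

/-- Each differentiation removes one trial from the expectation, hence the form `m + 2`. -/
lemma concaveOn_binomialNatEntropy (m : ℕ) :
    ConcaveOn ℝ (Set.Ioo 0 1) (binomialNatEntropy (m + 2)) := by
  set a : ℕ → ℝ := fun k => Real.log ((m + 2).choose k)
  have hent : ∀ x ∈ Set.Ioo (0 : ℝ) 1, HasDerivAt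
      (fun p => Real.log (1 - p) - Real.log p) (-1 / (x * (1 - x))) x := by
    intro x hx
    have h1 : (1 : ℝ) - x ≠ 0 := (sub_pos.2 hx.2).ne'
    have h0 : x ≠ 0 := hx.1.ne'
    refine ((((hasDerivAt_id x).const_sub 1).log h1).sub (Real.hasDerivAt_log h0)).congr_deriv ?_
    simp only [id]
    field_simp
    ring
  have hd1 : ∀ x ∈ Set.Ioo (0 : ℝ) 1, HasDerivAt (binomialNatEntropy (m + 2))
      (((m + 2 : ℕ) : ℝ) * (Real.log (1 - x) - Real.log x) - (((m + 1 : ℕ) : ℝ) + 1) *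
        pairing (fun k => a (k + 1) - a k) (bernoulliPoly (Multiset.replicate (m + 1) x))) x :=
    fun x hx => ((Real.hasDerivAt_binEntropy hx.1.ne' hx.2.ne).const_mul _).sub
      (hasDerivAt_pairing_replicate (m + 1) a x)
  have hd2 : ∀ x ∈ Set.Ioo (0 : ℝ) 1, HasDerivAt (fun x =>
      (((m + 2 : ℕ) : ℝ) * (Real.log (1 - x) - Real.log x) - (((m + 1 : ℕ) : ℝ) + 1) *
        pairing (fun k => a (k + 1) - a k) (bernoulliPoly (Multiset.replicate (m + 1) x))))
      (((m + 2 : ℕ) : ℝ) * (-1 / (x * (1 - x))) - (((m + 1 : ℕ) : ℝ) + 1) * ((m + 1) *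
        pairing (fun k => (a (k + 1 + 1) - a (k + 1)) - (a (k + 1) - a k))
          (bernoulliPoly (Multiset.replicate m x)))) x :=
    fun x hx => ((hent x hx).const_mul _).sub
      ((hasDerivAt_pairing_replicate m (fun k => a (k + 1) - a k) x).const_mul _)
  refine concaveOn_of_hasDerivWithinAt2_nonpos (convex_Ioo 0 1)
    (fun x hx => (hd1 x hx).continuousAt.continuousWithinAt)
    (fun x hx => (hd1 x (interior_subset hx)).hasDerivWithinAt)
    (fun x hx => (hd2 x (interior_subset hx)).hasDerivWithinAt) fun x hx => ?_
  have hx := interior_subset hx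
  have h := mul_le_mul_of_nonneg_left (binomial_second_derivative_nonpos m hx.1 hx.2)
    (by positivity : (0 : ℝ) ≤ (m : ℝ) + 2)
  push_cast
  simp only [a, add_assoc] at h ⊢
  norm_num at h ⊢
  linarith

lemma binomialNatEntropy_le_half (n : ℕ) {p : ℝ} (hp : 0 < p) (hp1 : p < 1) :
    binomialNatEntropy n p ≤ binomialNatEntropy n (1 / 2) := by
  match n with
  | 0 => simp [binomialNatEntropy, bernoulliPoly]
  | 1 =>
    have : ∀ p : ℝ, binomialNatEntropy 1 p = Real.binEntropy p := by
      intro p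
      have hd : (bernoulliPoly (Multiset.replicate 1 p)).natDegree < 2 :=
        Nat.lt_succ_of_le (by simpa using natDegree_bernoulliPoly_le (Multiset.replicate 1 p))
      rw [binomialNatEntropy, pairing_apply _ _ hd]
      simp [Finset.sum_range_succ]
    rw [this, this, one_div, Real.binEntropy_two_inv]
    exact Real.binEntropy_le_log_two
  | m + 2 =>
    have hp' : 1 - p ∈ Set.Ioo (0 : ℝ) 1 := ⟨by linarith, by linarith⟩
    have h := (concaveOn_binomialNatEntropy m).2 (Set.mem_Ioo.2 ⟨hp, hp1⟩) hp'
      (by norm_num : (0 : ℝ) ≤ 1 / 2) (by norm_num : (0 : ℝ) ≤ 1 / 2) (by norm_num)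
    rw [binomialNatEntropy_one_sub, ← add_smul, ← smul_add] at h
    norm_num at h ⊢
    exact h

/-! ### The maximum over Bernoulli sums -/

/-- The Shepp–Olkin maximum: the entropy of a sum of `n` independent Bernoulli variables is largest
when all the parameters are `1 / 2`. -/
lemma natEntropy_bernoulliPoly_le {n : ℕ} {s : Multiset ℝ} (hs : s.card = n)
    (hs1 : ∀ q ∈ s, 0 ≤ q ∧ q ≤ 1) :
    natEntropy (bernoulliPoly s) ≤
      natEntropy (bernoulliPoly (Multiset.replicate n (1 / 2))) := by
  have hnonneg : 0 ≤ natEntropy (bernoulliPoly (Multiset.replicate n (1 / 2))) := by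
    rw [natEntropy_eq_sum _ (Nat.lt_succ_of_le (natDegree_bernoulliPoly_le _))]
    have hc := bernoulliPoly_coeff_nonneg (s := Multiset.replicate n (1 / 2)) (fun q hq => by
      rw [Multiset.eq_of_mem_replicate hq]; norm_num)
    refine Finset.sum_nonneg fun k hk => Real.negMulLog_nonneg (hc k) ?_
    refine le_trans ?_ (sum_coeff_bernoulliPoly (Multiset.replicate n (1 / 2))).le
    exact Finset.single_le_sum (fun k _ => hc k) hk
  rcases Nat.eq_zero_or_pos n with rfl | hn
  · rw [Multiset.card_eq_zero.1 hs]; simp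
  have hn' : (0 : ℝ) < n := by exact_mod_cast hn
  have hsum0 : 0 ≤ s.sum := Multiset.sum_nonneg fun q hq => (hs1 q hq).1
  have hsum1 : s.sum ≤ n := by
    have := Multiset.sum_le_card_nsmul s 1 fun q hq => (hs1 q hq).2
    simpa [hs] using this
  -- Mean `0` or `n` forces a deterministic sum, of entropy `0`; the cross entropy needs `0 < p <
  -- 1`.
  rcases hsum0.eq_or_lt with h0 | h0
  · have : s = Multiset.replicate n 0 := Multiset.eq_replicate.2 ⟨hs, fun q hq =>
      le_antisymm (h0 ▸ Multiset.single_le_sum (fun x hx => (hs1 x hx).1) q hq) (hs1 q hq).1⟩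
    rw [this]
    refine le_trans (le_of_eq ?_) hnonneg
    have : bernoulliPoly (Multiset.replicate n 0) = C 1 := by simp [bernoulliPoly]
    rw [this, natEntropy, sum_C_index (by simp), Real.negMulLog_one]
  rcases hsum1.eq_or_lt with h1 | h1
  · have : s = Multiset.replicate n 1 := by
      refine Multiset.eq_replicate.2 ⟨hs, fun q hq => le_antisymm (hs1 q hq).2 ?_⟩
      obtain ⟨t, rfl⟩ := Multiset.exists_cons_of_mem hq
      have := Multiset.sum_le_card_nsmul t 1 fun q hq => (hs1 q (Multiset.mem_cons_of_mem hq)).2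
      simp only [Multiset.sum_cons, Multiset.card_cons, nsmul_eq_mul, mul_one] at *
      rw [← hs] at h1
      push_cast at h1
      linarith
    rw [this]
    refine le_trans (le_of_eq ?_) hnonneg
    simp [bernoulliPoly, natEntropy, X_pow_eq_monomial]
  have hp : 0 < s.sum / n := by positivity
  have hp1 : s.sum / n < 1 := by rwa [div_lt_one hn']
  have hmean : s.sum = n * (s.sum / n) := by field_simp
  have hoeff := pairing_replicate_le (n := n) (a := fun k => Real.log (n.choose k))
    (fun k hk => log_choose_concave hk) ⟨hp.le, hp1.le⟩ n s 0 hs hs1 hmean (by simp)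
  rw [zero_add, Multiset.replicate_zero, zero_add] at hoeff
  rw [natEntropy_replicate (by norm_num) (by norm_num)]
  refine (natEntropy_bernoulliPoly_le_crossEntropy hs hs1 hp hp1 hmean).trans
    (le_trans ?_ (binomialNatEntropy_le_half n hp hp1))
  rw [binomialNatEntropy]
  linarith

/-! ### Splitting by parity and optimizing the weight -/

lemma natEntropy_expand_add (p q : ℝ[X]) :
    natEntropy (expand ℝ 2 p + X * expand ℝ 2 q) = natEntropy p + natEntropy q := by
  set r := expand ℝ 2 p + X * expand ℝ 2 q with hr
  have heven : ∀ k, r.coeff (2 * k) = p.coeff k := by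
    intro k
    have : (X * expand ℝ 2 q).coeff (2 * k) = 0 := by
      rcases k with _ | k
      · simp
      · rw [show 2 * (k + 1) = 2 * k + 1 + 1 by ring, coeff_X_mul, coeff_expand two_pos,
          if_neg (by omega)]
    rw [hr, coeff_add, this, coeff_expand_mul' two_pos, add_zero]
  have hodd : ∀ k, r.coeff (2 * k + 1) = q.coeff k := by
    intro k
    rw [hr, coeff_add, coeff_X_mul, coeff_expand two_pos, if_neg (by omega), zero_add,
      coeff_expand_mul' two_pos]
  have hsum : ∀ N, ∑ k ∈ Finset.range (2 * N), Real.negMulLog (r.coeff k) =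
      ∑ k ∈ Finset.range N, Real.negMulLog (p.coeff k) +
        ∑ k ∈ Finset.range N, Real.negMulLog (q.coeff k) := by
    intro N
    induction N with
    | zero => simp
    | succ N ih =>
      rw [show 2 * (N + 1) = 2 * N + 1 + 1 by ring, Finset.sum_range_succ, Finset.sum_range_succ,
        ih, heven, hodd, Finset.sum_range_succ, Finset.sum_range_succ]
      ring
  set N := r.natDegree + p.natDegree + q.natDegree + 1
  rw [natEntropy_eq_sum r (N := 2 * N) (by omega), natEntropy_eq_sum p (N := N) (by omega),
    natEntropy_eq_sum q (N := N) (by omega), hsum]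

lemma natEntropy_C_mul (w : ℝ) (q : ℝ[X]) :
    natEntropy (C w * q) = q.eval 1 * Real.negMulLog w + w * natEntropy q := by
  have hd : (C w * q).natDegree < q.natDegree + 1 := Nat.lt_succ_of_le (natDegree_C_mul_le w q)
  rw [natEntropy_eq_sum _ hd, natEntropy_eq_sum q (Nat.lt_succ_self _), eval_eq_sum_range,
    Finset.sum_mul, Finset.mul_sum, ← Finset.sum_add_distrib]
  simp [Real.negMulLog_mul]

lemma natDegree_contract_two_le {p : ℝ[X]} {n : ℕ} (h : p.natDegree < 2 * (n + 1)) :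
    (contract 2 p).natDegree ≤ n := by
  refine natDegree_le_iff_coeff_eq_zero.2 fun k hk => ?_
  rw [coeff_contract two_ne_zero]
  exact coeff_eq_zero_of_natDegree_lt (by omega)

/-- Weight `w` on a law of entropy `A` and weight `1 - w` on a law of entropy `B` with
disjoint supports: the entropy of the mixture. -/
noncomputable def mixtureEntropy (A B w : ℝ) : ℝ :=
  Real.negMulLog w + w * A + (Real.negMulLog (1 - w) + (1 - w) * B)

/-- Gibbs' inequality for the weights `(w, 1 - w)` against `(v, 1 - v)`. Since `log (1 - v) - log v
= B - A`, the resulting bound does not depend on `w`. -/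
lemma mixtureEntropy_le {A B w v : ℝ} (hw : 0 ≤ w) (hw1 : w ≤ 1)
    (hv : v = 1 / (1 + Real.exp (B - A))) : mixtureEntropy A B w ≤ mixtureEntropy A B v := by
  have hpos : 0 < 1 + Real.exp (B - A) := by positivity
  have hv0 : 0 < v := by rw [hv]; positivity
  have hv1 : 1 - v = Real.exp (B - A) * v := by rw [hv]; field_simp; ring
  have hv1' : 0 < 1 - v := by rw [hv1]; positivity
  have hlog : Real.log (1 - v) = B - A + Real.log v := by
    rw [hv1, Real.log_mul (Real.exp_pos _).ne' hv0.ne', Real.log_exp]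
  have h1 := negMulLog_le_neg_mul_log_add hw hv0
  have h2 := negMulLog_le_neg_mul_log_add (sub_nonneg.2 hw1) hv1'
  rw [mixtureEntropy, mixtureEntropy, Real.negMulLog_def]
  rw [Real.negMulLog_def] at h1 h2
  simp only [hlog] at *
  linarith

/-- The weight `w` is the probability of an even value. The degree bound leaves at most `m + 1`
Bernoulli factors in the even part and `m` in the odd part. -/
lemma DominatesReflection.natEntropy_le {p : ℝ[X]} {m : ℕ} (hp : DominatesReflection p)
    (hcoeff : ∀ k, 0 ≤ p.coeff k) (hone : p.eval 1 = 1) (hdeg : p.natDegree ≤ 2 * (m + 1)) :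
    ∃ w, 0 ≤ w ∧ w ≤ 1 ∧ natEntropy p ≤
      mixtureEntropy (natEntropy (bernoulliPoly (Multiset.replicate (m + 1) (1 / 2))))
        (natEntropy (bernoulliPoly (Multiset.replicate m (1 / 2)))) w := by
  have hdivX : p.divX.natDegree < 2 * (m + 1) := by rw [natDegree_divX_eq_natDegree_tsub_one]; omega
  have heval : (contract 2 p).eval 1 + (contract 2 p.divX).eval 1 = 1 := by
    refine Eq.trans ?_ hone
    conv_rhs => rw [← expand_contract_two_add p]
    simp [expand_eval]
  have hnonneg : ∀ q : ℝ[X], (∀ k, 0 ≤ q.coeff k) → 0 ≤ q.eval 1 := by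
    intro q hq
    rw [eval_eq_sum_range]
    exact Finset.sum_nonneg fun k _ => by simpa using hq k
  have hE0 : 0 ≤ (contract 2 p).eval 1 := hnonneg _ fun k => by
    rw [coeff_contract two_ne_zero]; exact hcoeff _
  have hO0 : 0 ≤ (contract 2 p.divX).eval 1 := hnonneg _ fun k => by
    rw [coeff_contract two_ne_zero, coeff_divX]; exact hcoeff _
  have key : ∀ (q : ℝ[X]) (n : ℕ), q.natDegree ≤ n → 0 ≤ q.eval 1 →
      (q ≠ 0 → ∀ z : ℂ, aeval z q = 0 → z.im = 0 ∧ z.re ≤ 0) →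
      natEntropy q ≤ Real.negMulLog (q.eval 1) +
        q.eval 1 * natEntropy (bernoulliPoly (Multiset.replicate n (1 / 2))) := by
    intro q n hn hq0 hroots
    by_cases h0 : q = 0
    · simp [h0, natEntropy]
    obtain ⟨s, hs, hs1, hq⟩ := exists_bernoulliPoly n q hn (hroots h0)
    have : natEntropy q = Real.negMulLog (q.eval 1) + q.eval 1 * natEntropy (bernoulliPoly s) := by
      conv_lhs => rw [hq, natEntropy_C_mul, bernoulliPoly_eval_one, one_mul]
    rw [this]
    gcongr
    exact natEntropy_bernoulliPoly_le hs hs1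
  refine ⟨(contract 2 p).eval 1, hE0, by linarith, ?_⟩
  conv_lhs => rw [← expand_contract_two_add p, natEntropy_expand_add]
  rw [mixtureEntropy, show 1 - (contract 2 p).eval 1 = (contract 2 p.divX).eval 1 by linarith]
  exact add_le_add
    (key _ _ (natDegree_contract_two_le (by omega)) hE0 fun h _ hz => hp.roots_even h hz)
    (key _ _ (natDegree_contract_two_le hdivX) hO0 fun h _ hz => hp.roots_odd h hz)

/-! ### From nats to bits, and the extremal value -/

lemma shannonEntropy_eq_natEntropy {μ : Measure ℕ} {q : ℝ[X]} (h : ∀ k, μ.real {k} = q.coeff k) :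
    shannonEntropy μ = natEntropy q / Real.log 2 := by
  rw [shannonEntropy, tsum_eq_sum (s := Finset.range (q.natDegree + 1)),
    natEntropy_eq_sum q (Nat.lt_succ_self _), Finset.sum_div, ← Finset.sum_neg_distrib]
  · refine Finset.sum_congr rfl fun k _ => ?_
    rw [h, Real.negMulLog, Real.logb]
    ring
  · intro k hk
    rw [h, coeff_eq_zero_of_natDegree_lt (by simpa using hk), zero_mul]

lemma binomialEntropy_eq_natEntropy (n : ℕ) :
    binomialEntropy n =
      natEntropy (bernoulliPoly (Multiset.replicate n (1 / 2))) / Real.log 2 := by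
  refine shannonEntropy_eq_natEntropy fun k => ?_
  rw [binomial_real_singleton, coeff_bernoulliPoly_replicate]
  rfl

lemma optimalWeight_succ (m : ℕ) : optimalWeight (m + 1) =
    1 / (1 + Real.exp (natEntropy (bernoulliPoly (Multiset.replicate m (1 / 2))) -
      natEntropy (bernoulliPoly (Multiset.replicate (m + 1) (1 / 2))))) := by
  have h2 : Real.log 2 ≠ 0 := (Real.log_pos one_lt_two).ne'
  rw [optimalWeight, Nat.add_sub_cancel, Real.rpow_def_of_pos two_pos, binomialEntropy_eq_natEntropy,
    binomialEntropy_eq_natEntropy]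
  congr 3
  field_simp
  ring

lemma optimalWeight_pos (n : ℕ) : 0 < optimalWeight n := by
  rw [optimalWeight]; positivity

lemma optimalWeight_le_one (n : ℕ) : optimalWeight n ≤ 1 := by
  have : (0 : ℝ) < 2 ^ (-binomialEntropy n + binomialEntropy (n - 1)) := by positivity
  rw [optimalWeight, div_le_one (by positivity)]
  linarith

lemma maximalEntropy_succ (m : ℕ) : maximalEntropy (m + 1) =
    mixtureEntropy (natEntropy (bernoulliPoly (Multiset.replicate (m + 1) (1 / 2))))
        (natEntropy (bernoulliPoly (Multiset.replicate m (1 / 2)))) (optimalWeight (m + 1)) /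
      Real.log 2 := by
  have h2 : Real.log 2 ≠ 0 := (Real.log_pos one_lt_two).ne'
  rw [maximalEntropy, mixtureEntropy, binaryEntropy, Nat.add_sub_cancel,
    binomialEntropy_eq_natEntropy, binomialEntropy_eq_natEntropy, Real.logb, Real.logb, Real.negMulLog,
    Real.negMulLog]
  field_simp
  ring

/-- The entropy of the extremal law. -/
lemma natEntropy_extremal (m : ℕ) (w : ℝ) :
    natEntropy ((C (1 / 2) + C (1 / 2) * X ^ 2) ^ m * (C (w / 2) + C (1 - w) * X +
        C (w / 2) * X ^ 2)) =
      mixtureEntropy (natEntropy (bernoulliPoly (Multiset.replicate (m + 1) (1 / 2))))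
        (natEntropy (bernoulliPoly (Multiset.replicate m (1 / 2)))) w := by
  have hb : ∀ k, bernoulliPoly (Multiset.replicate k (1 / 2)) =
      (C (1 / 2) + C (1 / 2) * X) ^ k := fun k => by
    simp only [bernoulliPoly, Multiset.map_replicate, Multiset.prod_replicate]
    norm_num
  -- As `w/2 + (w/2) x² = w (1 + x²)/2`, the even and odd parts are exactly `w` and `1 - w` times
  -- symmetric binomial polynomials.
  have hsplit : (C (1 / 2) + C (1 / 2) * X ^ 2) ^ m * (C (w / 2) + C (1 - w) * X +
        C (w / 2) * X ^ 2) =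
      expand ℝ 2 (C w * bernoulliPoly (Multiset.replicate (m + 1) (1 / 2))) +
        X * expand ℝ 2 (C (1 - w) * bernoulliPoly (Multiset.replicate m (1 / 2))) := by
    rw [hb, hb]
    simp only [map_mul, map_pow, map_add, expand_C, expand_X]
    rw [show w / 2 = w * (1 / 2) by ring, C_mul]
    ring
  rw [hsplit, natEntropy_expand_add, natEntropy_C_mul, natEntropy_C_mul, bernoulliPoly_eval_one,
    bernoulliPoly_eval_one, one_mul, one_mul, mixtureEntropy]

/-! ### Laws of independent sums -/

lemma mgf_natCast {Ω : Type*} [MeasurableSpace Ω] {P : Measure Ω} [IsProbabilityMeasure P]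
    {Y : Ω → ℕ} (hY : Measurable Y) {N : ℕ} (hN : ∀ᵐ ω ∂P, Y ω < N) (t : ℝ) :
    mgf (fun ω => (Y ω : ℝ)) P t =
      ∑ k ∈ Finset.range N, P.real {ω | Y ω = k} * Real.exp t ^ k := by
  have hset : ∀ k, MeasurableSet {ω | Y ω = k} := fun k => hY (measurableSet_singleton k)
  have hae : (fun ω => Real.exp (t * (Y ω : ℝ))) =ᵐ[P] fun ω => ∑ k ∈ Finset.range N,
      {ω | Y ω = k}.indicator (fun _ => Real.exp t ^ k) ω := by
    filter_upwards [hN] with ω hω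
    rw [Finset.sum_eq_single (Y ω)]
    · simp [← Real.exp_nat_mul, mul_comm]
    · intro k _ hk
      simp [Set.indicator, hk.symm]
    · intro h
      exact absurd (Finset.mem_range.2 hω) h
  rw [mgf, integral_congr_ae hae, integral_finsetSum]
  · simp [integral_indicator_const _ (hset _)]
  · exact fun k _ => (integrable_const _).indicator (hset k)

/-- The generating function of the law of a random variable with values `0`, `1` and `2`. -/
noncomputable def quadraticLaw {Ω : Type*} [MeasurableSpace Ω] (P : Measure Ω) (Y : Ω → ℕ) :
    ℝ[X] :=
  C (P.real {ω | Y ω = 0}) + C (P.real {ω | Y ω = 1}) * X + C (P.real {ω | Y ω = 2}) * X ^ 2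

lemma natDegree_quadraticLaw_le {Ω : Type*} [MeasurableSpace Ω] (P : Measure Ω) (Y : Ω → ℕ) :
    (quadraticLaw P Y).natDegree ≤ 2 := by
  have : quadraticLaw P Y = C (P.real {ω | Y ω = 2}) * X ^ 2 + C (P.real {ω | Y ω = 1}) * X +
      C (P.real {ω | Y ω = 0}) := by
    rw [quadraticLaw]
    ring
  rw [this]
  exact natDegree_quadratic_le

section IndependentSum

variable {Ω : Type*} [MeasurableSpace Ω] {P : Measure Ω} [IsProbabilityMeasure P] {n : ℕ}
  {X : Fin n → Ω → ℕ}

/-- Independence multiplies moment generating functions. At `t = log x` these are values of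
generating polynomials at `x`, and polynomials agreeing for all `x > 0` coincide. -/
lemma real_map_sum_singleton (hX : ∀ i, Measurable (X i)) (hind : iIndepFun X P)
    (hval : ∀ i, ∀ᵐ ω ∂P, X i ω ∈ ({0, 1, 2} : Set ℕ)) (k : ℕ) :
    (P.map fun ω => ∑ i, X i ω).real {k} = (∏ i, quadraticLaw P (X i)).coeff k := by
  set S : Ω → ℕ := fun ω => ∑ i, X i ω with hS
  have hSm : Measurable S := Finset.measurable_sum _ fun i _ => hX i
  have hlt : ∀ i, ∀ᵐ ω ∂P, X i ω < 3 := by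
    intro i
    filter_upwards [hval i] with ω hω
    simp only [Set.mem_insert_iff, Set.mem_singleton_iff] at hω
    omega
  have hSlt : ∀ᵐ ω ∂P, S ω < 2 * n + 1 := by
    filter_upwards [ae_all_iff.2 hlt] with ω hω
    have : ∑ i, X i ω ≤ ∑ _i : Fin n, 2 := Finset.sum_le_sum fun i _ => Nat.lt_succ_iff.1 (hω i)
    simp at this
    simp only [hS]
    omega
  have hind' : iIndepFun (fun i ω => (X i ω : ℝ)) P :=
    hind.comp (fun _ m => (m : ℝ)) fun _ => measurable_from_nat
  have hmgf : ∀ t, mgf (fun ω => (S ω : ℝ)) P t = ∏ i, mgf (fun ω => (X i ω : ℝ)) P t := by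
    intro t
    rw [← hind'.mgf_sum (fun i => measurable_from_nat.comp (hX i)) Finset.univ]
    congr 1
    ext ω
    simp [hS]
  have hpoly : ∑ j ∈ Finset.range (2 * n + 1), C (P.real {ω | S ω = j}) * Polynomial.X ^ j =
      ∏ i, quadraticLaw P (X i) := by
    refine eq_of_infinite_eval_eq _ _ ((Set.Ioi_infinite (0 : ℝ)).mono fun x hx => ?_)
    have h := hmgf (Real.log x)
    rw [mgf_natCast hSm hSlt] at h
    simp only [mgf_natCast (hX _) (hlt _)] at h
    rw [Real.exp_log hx] at h
    simp only [Set.mem_ofPred_eq, eval_finsetSum, eval_prod, quadraticLaw, eval_add, eval_mul,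
      eval_C, eval_pow, eval_X]
    rw [h]
    simp [Finset.sum_range_succ]
  rw [map_measureReal_apply hSm (measurableSet_singleton k), ← hpoly]
  simp only [finsetSum_coeff, coeff_C_mul_X_pow, Finset.sum_ite_eq, Finset.mem_range]
  split_ifs with hk
  · rfl
  · rw [measureReal_eq_zero_iff]
    refine measure_mono_null (fun ω hω => ?_) (ae_iff.1 hSlt)
    have : S ω = k := hω
    exact fun h => hk (this ▸ h)

lemma quadraticLaw_sum_eq_one {Y : Ω → ℕ} (hY : Measurable Y)
    (hval : ∀ᵐ ω ∂P, Y ω ∈ ({0, 1, 2} : Set ℕ)) :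
    P.real {ω | Y ω = 0} + P.real {ω | Y ω = 1} + P.real {ω | Y ω = 2} = 1 := by
  have h := mgf_natCast (P := P) hY (N := 3) (by
    filter_upwards [hval] with ω hω
    simp only [Set.mem_insert_iff, Set.mem_singleton_iff] at hω
    omega) 0
  simpa [Finset.sum_range_succ] using h.symm

lemma ae_mem_of_sum_eq_one {Y : Ω → ℕ} (hY : Measurable Y) (T : Finset ℕ)
    (hT : ∑ k ∈ T, P.real {ω | Y ω = k} = 1) : ∀ᵐ ω ∂P, Y ω ∈ T := by
  have hprob : IsProbabilityMeasure (P.map Y) := Measure.isProbabilityMeasure_map hY.aemeasurable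
  have h : (P.map Y).real (T : Set ℕ) = 1 := by
    rw [← sum_measureReal_singleton, ← hT]
    exact Finset.sum_congr rfl fun k _ => map_measureReal_apply hY (measurableSet_singleton k)
  rw [map_measureReal_apply hY T.measurableSet] at h
  have h' : P (Y ⁻¹' T) = 1 := by
    rw [← ENNReal.toReal_eq_one_iff]; exact h
  exact (mem_ae_iff_prob_eq_one (hY T.measurableSet)).2 h'

lemma shannonEntropy_sum_le {m : ℕ} {X : Fin (m + 1) → Ω → ℕ} (hX : ∀ i, Measurable (X i))
    (hind : iIndepFun X P) (hval : ∀ i, ∀ᵐ ω ∂P, X i ω ∈ ({0, 1, 2} : Set ℕ)) :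
    shannonEntropy (P.map fun ω => ∑ i, X i ω) ≤ maximalEntropy (m + 1) := by
  have hcoeff := real_map_sum_singleton hX hind hval
  have hone := fun i => quadraticLaw_sum_eq_one (hX i) (hval i)
  have hdom : DominatesReflection (∏ i, quadraticLaw P (X i)) :=
    DominatesReflection.prod _ _ fun i _ => DominatesReflection.quadratic measureReal_nonneg
      measureReal_nonneg measureReal_nonneg (by rw [hone i]; exact one_pos)
  have heval : (∏ i, quadraticLaw P (X i)).eval 1 = 1 := by
    rw [eval_prod]
    exact Finset.prod_eq_one fun i _ => by simp [quadraticLaw, hone i]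
  have hdeg : (∏ i, quadraticLaw P (X i)).natDegree ≤ 2 * (m + 1) := by
    refine (natDegree_prod_le _ _).trans
      ((Finset.sum_le_card_nsmul _ _ 2 fun i _ => natDegree_quadraticLaw_le P (X i)).trans ?_)
    simp [mul_comm]
  obtain ⟨w, hw0, hw1, hw⟩ := hdom.natEntropy_le (fun k => hcoeff k ▸ measureReal_nonneg) heval hdeg
  rw [shannonEntropy_eq_natEntropy hcoeff, maximalEntropy_succ]
  exact div_le_div_of_nonneg_right (hw.trans (mixtureEntropy_le hw0 hw1 (optimalWeight_succ m)))
    (Real.log_pos one_lt_two).le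

lemma shannonEntropy_sum_eq {m : ℕ} {X : Fin (m + 1) → Ω → ℕ} (hX : ∀ i, Measurable (X i))
    (hind : iIndepFun X P) (hlaw : HasExtremalLaws P X) :
    shannonEntropy (P.map fun ω => ∑ i, X i ω) = maximalEntropy (m + 1) := by
  -- Only point masses are prescribed; the supports follow because these masses add up to one.
  have hinit : ∀ i : Fin m, ∀ᵐ ω ∂P, X i.castSucc ω ∈ ({0, 2} : Finset ℕ) := by
    intro i
    obtain ⟨h0, h2⟩ := (hlaw i.castSucc).1 (by simp)
    refine ae_mem_of_sum_eq_one (hX _) _ ?_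
    rw [Finset.sum_pair (by norm_num), h0, h2]
    norm_num
  obtain ⟨h0, h2, h1⟩ := (hlaw (Fin.last m)).2 (by simp)
  have hlast : ∀ᵐ ω ∂P, X (Fin.last m) ω ∈ ({0, 1, 2} : Finset ℕ) := by
    refine ae_mem_of_sum_eq_one (hX _) _ ?_
    rw [Finset.sum_insert (by norm_num), Finset.sum_pair (by norm_num), h0, h1, h2]
    ring
  have hval : ∀ i, ∀ᵐ ω ∂P, X i ω ∈ ({0, 1, 2} : Set ℕ) := by
    intro i
    induction i using Fin.lastCases with
    | last => filter_upwards [hlast] with ω hω using by simpa using hω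
    | cast i =>
      filter_upwards [hinit i] with ω hω
      simp only [Finset.mem_insert, Finset.mem_singleton] at hω
      rcases hω with h | h <;> simp [h]
  have hquad : ∀ i : Fin m, quadraticLaw P (X i.castSucc) =
      C (1 / 2) + C (1 / 2) * Polynomial.X ^ 2 := by
    intro i
    obtain ⟨h0, h2⟩ := (hlaw i.castSucc).1 (by simp)
    have hsum := quadraticLaw_sum_eq_one (hX i.castSucc) (hval _)
    have h1 : P.real {ω | X i.castSucc ω = 1} = 0 := by linarith
    rw [quadraticLaw, h0, h1, h2, C_0, zero_mul, add_zero]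
  rw [shannonEntropy_eq_natEntropy (real_map_sum_singleton hX hind hval), maximalEntropy_succ,
    Fin.prod_univ_castSucc, Finset.prod_congr rfl fun i _ => hquad i, Finset.prod_const,
    Finset.card_univ, Fintype.card_fin, quadraticLaw, h0, h1, h2, natEntropy_extremal]

end IndependentSum

/-! ### Existence of extremal variables on a product space -/

/-- The law on `{0, 1, 2}` with masses `a`, `b` and `c`. -/
noncomputable def threePointLaw (a b c : ℝ) : Measure (Fin 3) :=
  ENNReal.ofReal a • Measure.dirac 0 + ENNReal.ofReal b • Measure.dirac 1 +
    ENNReal.ofReal c • Measure.dirac 2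

lemma isProbabilityMeasure_threePointLaw {a b c : ℝ} (ha : 0 ≤ a) (hb : 0 ≤ b) (hc : 0 ≤ c)
    (h : a + b + c = 1) : IsProbabilityMeasure (threePointLaw a b c) := by
  constructor
  simp only [threePointLaw, Measure.coe_add, Measure.coe_smul, Pi.add_apply, Pi.smul_apply,
    measure_univ, smul_eq_mul, mul_one]
  rw [← ENNReal.ofReal_add ha hb, ← ENNReal.ofReal_add (by positivity) hc, h, ENNReal.ofReal_one]

lemma threePointLaw_real {a b c : ℝ} (ha : 0 ≤ a) (hb : 0 ≤ b) (hc : 0 ≤ c) :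
    (threePointLaw a b c).real {j | (j : ℕ) = 0} = a ∧
    (threePointLaw a b c).real {j | (j : ℕ) = 1} = b ∧
    (threePointLaw a b c).real {j | (j : ℕ) = 2} = c := by
  simp [threePointLaw, measureReal_def, Set.indicator, ha, hb, hc]

lemma exists_hasExtremalLaws (n : ℕ) :
    ∃ (Ω : Type) (_ : MeasurableSpace Ω) (P : Measure Ω) (_ : IsProbabilityMeasure P)
      (X : Fin n → Ω → ℕ), (∀ i, Measurable (X i)) ∧ iIndepFun X P ∧
      (∀ i ω, X i ω ∈ ({0, 1, 2} : Set ℕ)) ∧ HasExtremalLaws P X := by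
  set w := optimalWeight n
  have hw0 : 0 ≤ w / 2 := by linarith [optimalWeight_pos n]
  have hw1 : 0 ≤ 1 - w := sub_nonneg.2 (optimalWeight_le_one n)
  have hhalf : (0 : ℝ) ≤ 1 / 2 := by norm_num
  set μ : Fin n → Measure (Fin 3) := fun i =>
    if (i : ℕ) + 1 = n then threePointLaw (w / 2) (1 - w) (w / 2)
    else threePointLaw (1 / 2) 0 (1 / 2) with hμ
  have hprob : ∀ i, IsProbabilityMeasure (μ i) := by
    intro i
    simp only [hμ]
    split_ifs
    · exact isProbabilityMeasure_threePointLaw hw0 hw1 hw0 (by ring)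
    · exact isProbabilityMeasure_threePointLaw hhalf le_rfl hhalf (by norm_num)
  have hval : Measurable fun j : Fin 3 => (j : ℕ) := measurable_of_countable _
  have hreal : ∀ i k, (Measure.pi μ).real {ω | ((ω i : Fin 3) : ℕ) = k} =
      (μ i).real {j | (j : ℕ) = k} := fun i k =>
    (measurePreserving_eval μ i).measureReal_preimage
      (hval (measurableSet_singleton k)).nullMeasurableSet
  refine ⟨Fin n → Fin 3, inferInstance, Measure.pi μ, inferInstance, fun i ω => (ω i : ℕ),
    fun i => hval.comp (measurable_pi_apply i), iIndepFun_pi fun i => hval.aemeasurable, ?_, ?_⟩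
  · intro i ω
    have := (ω i).isLt
    simp only [Set.mem_insert_iff, Set.mem_singleton_iff]
    omega
  · intro i
    simp only [hreal]
    refine ⟨fun hi => ?_, fun hi => ?_⟩
    · have h := threePointLaw_real hhalf le_rfl hhalf
      simp only [hμ, if_neg hi.ne]
      exact ⟨h.1, h.2.2⟩
    · have h := threePointLaw_real hw0 hw1 hw0
      simp only [hμ, if_pos hi]
      exact ⟨h.1, h.2.2, h.2.1⟩

end EntropyOfSums

theorem theorem1 (n : ℕ) (hn : 1 ≤ n) :
    -- the upper bound
    (∀ (Ω : Type*) [MeasurableSpace Ω] (P : Measure Ω) [IsProbabilityMeasure P]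
      (X : Fin n → Ω → ℕ), (∀ i, Measurable (X i)) → iIndepFun X P →
      (∀ i, ∀ᵐ ω ∂P, X i ω ∈ ({0, 1, 2} : Set ℕ)) →
      shannonEntropy (P.map (fun ω => ∑ i, X i ω)) ≤ maximalEntropy n) ∧
    -- equality for independent variables with the extremal laws
    (∀ (Ω : Type*) [MeasurableSpace Ω] (P : Measure Ω) [IsProbabilityMeasure P]
      (X : Fin n → Ω → ℕ), (∀ i, Measurable (X i)) → iIndepFun X P →
      HasExtremalLaws P X →
      shannonEntropy (P.map (fun ω => ∑ i, X i ω)) = maximalEntropy n) ∧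
    -- such variables exist, so the bound is attained
    (∃ (Ω : Type) (_ : MeasurableSpace Ω) (P : Measure Ω) (_ : IsProbabilityMeasure P)
      (X : Fin n → Ω → ℕ), (∀ i, Measurable (X i)) ∧ iIndepFun X P ∧
      (∀ i ω, X i ω ∈ ({0, 1, 2} : Set ℕ)) ∧ HasExtremalLaws P X ∧
      shannonEntropy (P.map (fun ω => ∑ i, X i ω)) = maximalEntropy n) := by
  obtain ⟨m, rfl⟩ := Nat.exists_eq_add_of_le' hn
  refine ⟨fun Ω _ P _ X hX hind hval => shannonEntropy_sum_le hX hind hval,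
    fun Ω _ P _ X hX hind hlaw => shannonEntropy_sum_eq hX hind hlaw, ?_⟩
  obtain ⟨Ω, _, P, hP, X, hX, hind, hval, hlaw⟩ := exists_hasExtremalLaws (m + 1)
  exact ⟨Ω, _, P, hP, X, hX, hind, hval, hlaw, shannonEntropy_sum_eq hX hind hlaw⟩
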